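/- **Setting.** Let $n,m,u\ge 0$ be integers, let parties $P_0,\dots,P_{n-1}$ hold private integers $x_0,\dots,x_{n-1}\in\{1,\dots,2^m-1\}$, and let $T=\mathrm{lcm}(x_0,\dots,x_{n-1})$. There are $u$-qubit registers $h,t$ and an $m$-qubit register $e_i$ private to each $P_i$, all starting in $|0\rangle$. In the (semi-honest) LCM protocol $P_0$ applies $H^{\otimes u}$ to $h$ and bitwise CNOT from $h$ to $t$; then $P_0,\dots,P_{n-1}$ in turn receive $t$ and apply $|j\rangle_t|y\rangle_{e_i}\mapsto|j\rangle_t|y\oplus(j \bmod x_i)\rangle_{e_i}$; then $P_0$ applies bitwise CNOT from $h$ to $t$ again, measures $t$ (accepting only the outcome $0$), applies $\mathrm{QFT}^\dagger$ to $h$, and measures $h$ with outcome $k$. Write $\omega=e^{2\pi\imath/2^u}$, $[N]=\{0,\dots,N-1\}$, $\rho_a(Y)=2^{-u}\,|\{j\in[2^u]: j\bmod a=Y\}|$ and $w_Z(d)=4^{-u}\bigl|\sum_{j\in[2^u],\,j\bmod T=Z}\omega^{jd}\bigr|^2$. All measurements are in the computational basis. **Theorem.** For every party $P_i$ the following three attacks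 give no information beyond $x_i$ and the public output $T$. 1. *Direct measurement.* At any time at which $s\in\{0,\dots,n\}$ parties have applied their operation and before the second CNOT of $P_0$, measuring $h$, or measuring $t$, gives each $j\in[2^u]$ with probability $2^{-u}$, and, if $P_i$ is among those $s$ parties, measuring $e_i$ gives each $Y\in[2^m]$ with probability $\rho_{x_i}(Y)$. After the second CNOT, $t$ is $0$ with probability $1$, and the statements on $h$ and $e_i$ still hold. At the end (right before $h$ is measured, equivalently averaged over $k$) $e_i$ again has the distribution $\rho_{x_i}$, and the pair of outcomes $(k,Y)$ of $h$ and $e_i$ has probability $\sum_{Z\in[T],\,Z\bmod x_i=Y}w_Z(k)$. If $T\mid 2^u$, then $k$ is uniform on the $T$ multiples of $2^u/T$ in $[2^u]$, and, given any such $k$, $e_i$ takes each value $Y\in[x_i]$ with probability $1/x_i$. For all $Y\in[x_i]$, $|\rho_{x_i}(Y)-1/x_i|<2^{-u}$, and $\rho_{x_i}(Y)=1/x_i$ if $x_i\mid 2^u$. 2. *Inverse Fourier transform before period finding.* If at any time at which $s\in\{0,\dots,n\}$ parties have applied their operation and before the second CNOT, $\mathrm{QFT}^\dagger$ is applied to $h$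 (respectively to $t$), then measuring that register gives each $k\in[2^u]$ with probability $2^{-u}$. 3. *Copy, and Fourier transform after period finding.* Suppose that at any such time the content of $t$ is copied by bitwise CNOT to a further $u$-qubit register $c$ initially in $|0\rangle$, that everybody then proceeds as prescribed, and that, after $P_0$ has measured $h$ with outcome $k$, $\mathrm{QFT}$ is applied to $c$ and $c$ is measured. Then the measurement of $t$ gives $0$ with probability $1$; each $k\in[2^u]$ has probability $2^{-u}$; given $k$, the outcome of $c$ is $l\in[2^u]$ with probability $\sum_{Z\in[T]}w_Z(l-k)$, which, if $T\mid2^u$, is $1/T$ when $l\equiv k+r\,2^u/T \pmod{2^u}$ for some $r\in[T]$ and $0$ otherwise; and averaged over $k$ each $l\in[2^u]$ has probability $2^{-u}$. Moreover, whether or not $T$ divides $2^u$: for any two tuples of private inputs with the same $x_i$, the joint distributions of the outcomes of $h,t,c,e_i$ agree at every time before $P_0$'s transform of $h$ in (1), and in (2); and if the two tuples also have the same least common multiple, the joint distributions of these outcomes also agree at the end of period finding in (1) (before the measurement of $h$, and after it given any outcome $k$), and in (3) the distribution of $k$ and, given any $k$, the joint distribution of the outcomes of $h,t,c,e_i$ agree.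 -/

import Mathlib

namespace QLCM

open scoped BigOperators

/-! Registers.  The global system has an index register `h`, a travelling register `t`, a register
`c` used only by a party who copies the content of `t`, all of `u` qubits, and for each of the
`n` parties a private `m`-qubit register `e i`.  A `q`-qubit computational basis vector is labelled
by the integer in `Fin (2 ^ q)` whose binary digits are its bits. -/

/-- Labels of the computational basis: the values of `(h, t, c, (e i)_i)`. -/
abbrev Basis (n m u : ℕ) : Type :=
  Fin (2 ^ u) × Fin (2 ^ u) × Fin (2 ^ u) × (Fin n → Fin (2 ^ m))

variable {n m u : ℕ}

/-- The value of register `h`. -/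
abbrev regH (b : Basis n m u) : Fin (2 ^ u) := b.1
/-- The value of register `t`. -/
abbrev regT (b : Basis n m u) : Fin (2 ^ u) := b.2.1
/-- The value of register `c`. -/
abbrev regC (b : Basis n m u) : Fin (2 ^ u) := b.2.2.1
/-- The value of register `e i`. -/
abbrev regE (b : Basis n m u) (i : Fin n) : Fin (2 ^ m) := b.2.2.2 i

/-- A (pure) state, given by its amplitudes in the computational basis. -/
abbrev State (n m u : ℕ) : Type := Basis n m u → ℂ

/-- The computational basis vector with label `b`. -/
noncomputable def ket (b : Basis n m u) : State n m u := Pi.single b 1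

/-- The linear operator that sends the basis vector labelled `b` to the one labelled `g b`. -/
noncomputable def basisMap (g : Basis n m u → Basis n m u) (ψ : State n m u) : State n m u :=
  ∑ b, ψ b • ket (g b)

/-- The operator that acts as the matrix `A` on register `h` and as the identity elsewhere. -/
noncomputable def onH (A : Matrix (Fin (2 ^ u)) (Fin (2 ^ u)) ℂ) (ψ : State n m u) :
    State n m u :=
  fun b => ∑ y, A (regH b) y * ψ (y, regT b, regC b, regE b)

/-- The operator that acts as the matrix `A` on register `t` and as the identity elsewhere. -/
noncomputable def onT (A : Matrix (Fin (2 ^ u)) (Fin (2 ^ u)) ℂ) (ψ : State n m u) :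
    State n m u :=
  fun b => ∑ y, A (regT b) y * ψ (regH b, y, regC b, regE b)

/-- The operator that acts as the matrix `A` on register `c` and as the identity elsewhere. -/
noncomputable def onC (A : Matrix (Fin (2 ^ u)) (Fin (2 ^ u)) ℂ) (ψ : State n m u) :
    State n m u :=
  fun b => ∑ y, A (regC b) y * ψ (regH b, regT b, y, regE b)

/-! Elementary operators. -/

/-- Bitwise exclusive or of `q`-bit integers. -/
def xorBits {q : ℕ} (a b : Fin (2 ^ q)) : Fin (2 ^ q) :=
  ⟨a.val ^^^ b.val, Nat.xor_lt_two_pow a.isLt b.isLt⟩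

/-- The all-zero bit string. -/
def zeroBits (q : ℕ) : Fin (2 ^ q) := ⟨0, Nat.two_pow_pos q⟩

/-- The Hadamard gate on each of `u` qubits: the entry at `(j, x)` is `(-1) ^ (x · j)`, divided by
the square root of `2 ^ u`, with `x · j` the inner product of bit strings. -/
noncomputable def hadamard (u : ℕ) : Matrix (Fin (2 ^ u)) (Fin (2 ^ u)) ℂ :=
  Matrix.of fun j x =>
    (-1 : ℂ) ^ ((Finset.range u).filter
      (fun r => x.val.testBit r = true ∧ j.val.testBit r = true)).card
      / (Real.sqrt ((2 : ℝ) ^ u) : ℂ)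

/-- `exp (2 π i d / 2 ^ u)`. -/
noncomputable def phase (u : ℕ) (d : ℤ) : ℂ :=
  Complex.exp (2 * (Real.pi : ℂ) * Complex.I * (d : ℂ) / (2 : ℂ) ^ u)

/-- The quantum Fourier transform on `u` qubits. -/
noncomputable def qft (u : ℕ) : Matrix (Fin (2 ^ u)) (Fin (2 ^ u)) ℂ :=
  Matrix.of fun j x => phase u ((x.val : ℤ) * (j.val : ℤ)) / (Real.sqrt ((2 : ℝ) ^ u) : ℂ)

/-- The inverse quantum Fourier transform on `u` qubits. -/
noncomputable def qftInv (u : ℕ) : Matrix (Fin (2 ^ u)) (Fin (2 ^ u)) ℂ :=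
  Matrix.of fun j x => phase u (-((x.val : ℤ) * (j.val : ℤ))) / (Real.sqrt ((2 : ℝ) ^ u) : ℂ)

/-- Bitwise CNOT with control `h` and target `t`. -/
noncomputable def cnotHT : State n m u → State n m u :=
  basisMap fun b => (regH b, xorBits (regT b) (regH b), regC b, regE b)

/-- Bitwise CNOT with control `t` and target `c`: copies the label of `t` into a zeroed `c`. -/
noncomputable def cnotTC : State n m u → State n m u :=
  basisMap fun b => (regH b, regT b, xorBits (regC b) (regT b), regE b)

/-- The private function `j ↦ j mod a` of a party with input `a`, with `m`-bit values
(the outer reduction does nothing when `0 < a < 2 ^ m`). -/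
def residue (m u a : ℕ) (j : Fin (2 ^ u)) : Fin (2 ^ m) :=
  ⟨(j.val % a) % 2 ^ m, Nat.mod_lt _ (Nat.two_pow_pos m)⟩

/-- The oracle of party `i`: `|j⟩` in `t` and `|y⟩` in `e i` are sent to `|j⟩` and
`|y xor (j mod x i)⟩`. -/
noncomputable def oracle (x : Fin n → ℕ) (i : Fin n) : State n m u → State n m u :=
  basisMap fun b => (regH b, regT b, regC b,
    Function.update (regE b) i (xorBits (regE b i) (residue m u (x i) (regT b))))

/-! Measurements in the computational basis. -/

open Classical in
/-- Born rule: the probability that the measured label satisfies `P`. -/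
noncomputable def prob (ψ : State n m u) (P : Basis n m u → Prop) : ℝ :=
  ∑ b, if P b then ‖ψ b‖ ^ 2 else 0

open Classical in
/-- The normalized state after a measurement with outcome `P` (zero if the outcome has
probability zero). -/
noncomputable def collapse (P : Basis n m u → Prop) (ψ : State n m u) : State n m u :=
  fun b => if P b then ψ b / (Real.sqrt (prob ψ P) : ℂ) else 0

/-- The joint distribution of the outcomes of measuring `h`, `t`, `c` and the private register
`e i` of party `i`. -/
noncomputable def view (i : Fin n) (ψ : State n m u) (a b c : Fin (2 ^ u)) (Y : Fin (2 ^ m)) : ℝ :=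
  prob ψ fun w => regH w = a ∧ regT w = b ∧ regC w = c ∧ regE w i = Y

/-! The quantum part of the protocol with private inputs `x`. -/

/-- The state after party `0` has applied Hadamard gates to `h` and has copied `h` to `t`. -/
noncomputable def prepared : State n m u :=
  cnotHT (onH (hadamard u)
    (ket (zeroBits u, zeroBits u, zeroBits u, fun _ => zeroBits m)))

/-- Parties `s, s + 1, …, s + d - 1` (those below `n`) apply their oracles, in this order. -/
noncomputable def oraclesFrom (x : Fin n → ℕ) (s : ℕ) : ℕ → State n m u → State n m u
  | 0, ψ => ψ
  | d + 1, ψ =>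
    if hlt : s + d < n then oracle x ⟨s + d, hlt⟩ (oraclesFrom x s d ψ)
    else oraclesFrom x s d ψ

/-- The state when exactly the parties `0, …, s - 1` have applied their oracles. -/
noncomputable def stateAfter (x : Fin n → ℕ) (s : ℕ) : State n m u :=
  oraclesFrom x 0 s prepared

/-- Party `0`, having got `t` back, measures it after the second CNOT, accepts the outcome `0`,
and applies the inverse Fourier transform to `h`; the argument is the state after that CNOT. -/
noncomputable def checkAndTransform (ψ : State n m u) : State n m u :=
  onH (qftInv u) (collapse (fun b => regT b = zeroBits u) ψ)

/-- The state after the second CNOT of party `0`. -/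
noncomputable def uncomputed (x : Fin n → ℕ) : State n m u :=
  cnotHT (stateAfter x n)

/-- The state right before party `0` measures `h` to find the period. -/
noncomputable def final (x : Fin n → ℕ) : State n m u :=
  checkAndTransform (uncomputed x)

/-- The state after party `0` has measured `h` with outcome `k`. -/
noncomputable def afterPeriodFinding (x : Fin n → ℕ) (k : Fin (2 ^ u)) : State n m u :=
  collapse (fun b => regH b = k) (final x)

/-! The run in which an attacker copies `t` into `c` when parties `0, …, s - 1` have applied their
oracles; everybody then goes on as prescribed. -/

/-- The state after the second CNOT of party `0`, with a copy made at time `s`. -/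
noncomputable def uncomputedCopy (x : Fin n → ℕ) (s : ℕ) : State n m u :=
  cnotHT (oraclesFrom x s (n - s) (cnotTC (stateAfter x s)))

/-- The state right before party `0` measures `h`, with a copy made at time `s`. -/
noncomputable def finalCopy (x : Fin n → ℕ) (s : ℕ) : State n m u :=
  checkAndTransform (uncomputedCopy x s)

/-- The state after party `0` has found `k` in `h` and the attacker has then applied the Fourier
transform to the copy `c`. -/
noncomputable def attackedCopy (x : Fin n → ℕ) (s : ℕ) (k : Fin (2 ^ u)) : State n m u :=
  onC (qft u) (collapse (fun b => regH b = k) (finalCopy x s))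

/-! Explicit distributions. -/

/-- The number of `j < 2 ^ u` with `j mod a = Y`, divided by `2 ^ u`. -/
noncomputable def residueFreq (u a Y : ℕ) : ℝ :=
  (((Finset.range (2 ^ u)).filter (fun j => j % a = Y)).card : ℝ) / 2 ^ u

/-- The squared modulus of the sum of `exp (2 π i j d / 2 ^ u)` over `j < 2 ^ u` with
`j mod T = Z`, divided by `(2 ^ u) ^ 2`. -/
noncomputable def classWeight (u T Z : ℕ) (d : ℤ) : ℝ :=
  ‖∑ j ∈ (Finset.range (2 ^ u)).filter (fun j => j % T = Z), phase u ((j : ℤ) * d)‖ ^ 2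
    / (2 ^ u) ^ 2

end QLCM

namespace QLCM

open scoped BigOperators
variable {n m u : ℕ}

/-! Every state of the protocol is an explicit combination of basis vectors indexed by the value `y`
that the Hadamard gates put into `h`. All amplitudes start with equal modulus, the oracles only
write the residues of `y` into the private registers, and a Fourier transform only multiplies by
phases. So everything depends on whether two values of `y` can lead to the same basis vector.

As long as some register among `h`, `t`, `c` still holds `y`, they cannot. Nothing interferes, the
phases disappear from the squared moduli, and each probability is a count of values `y`. Such counts
see the other parties' inputs not at all, because `e i` holds only `y mod x i`. This settles
everything before period finding, and also the law of `k` in the copying attack.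

Once the transform has removed `y` from its last register, only the private registers remember it.
By `residues_eq_iff` they agree for `y` and `y'` exactly when `y` and `y'` are congruent modulo the
least common multiple `T`. Amplitudes therefore add up inside each class `Z` modulo `T`, which
produces the weights `classWeight` (`prob_superpose_residues`). In the copying attack the phases of
the two transforms combine, and `l - k` takes the place of `k`. In both cases the other inputs enter
only through `T`, since `e i` holds `Z mod x i`.

The remaining formulas are Fourier analysis modulo `2 ^ u`. Averaging a weight over `k` is
Parseval's identity (`parseval`); when `T` divides `2 ^ u`, each class is an arithmetic progression
and its sum is geometric (`classWeight_of_dvd`). -/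

/-- The combination of the basis vectors labelled `g p` with the coefficients `α p`. -/
noncomputable def superpose {ι : Type*} [Fintype ι] (α : ι → ℂ) (g : ι → Basis n m u) :
    State n m u :=
  ∑ p, α p • ket (g p)

/-! ### Operators and measurements on explicit superpositions -/

section superpose

variable {ι κ : Type*} [Fintype ι] [Fintype κ]

lemma superpose_apply (α : ι → ℂ) (g : ι → Basis n m u) (b : Basis n m u) :
    superpose α g b = ∑ p, if b = g p then α p else 0 := by
  simp [superpose, ket, Finset.sum_apply, Pi.single_apply]

lemma superpose_apply_of_injective (α : ι → ℂ) {g : ι → Basis n m u}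
    (hg : Function.Injective g) (p : ι) : superpose α g (g p) = α p := by
  classical
  simp [superpose_apply, hg.eq_iff]

lemma superpose_apply_eq_zero (α : ι → ℂ) {g : ι → Basis n m u} {b : Basis n m u}
    (hb : ∀ p, g p ≠ b) : superpose α g b = 0 := by
  rw [superpose_apply]
  exact Finset.sum_eq_zero fun p _ => if_neg (hb p).symm

lemma basisMap_superpose (f : Basis n m u → Basis n m u) (α : ι → ℂ) (g : ι → Basis n m u) :
    basisMap f (superpose α g) = superpose α (fun p => f (g p)) := by
  simp only [basisMap, superpose_apply, Finset.sum_smul, ite_smul, zero_smul]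
  rw [Finset.sum_comm]
  simp [superpose]

lemma cnotHT_superpose (α : ι → ℂ) (h t c : ι → Fin (2 ^ u)) (e : ι → Fin n → Fin (2 ^ m)) :
    cnotHT (superpose α fun p => (h p, t p, c p, e p)) =
      superpose α fun p => (h p, xorBits (t p) (h p), c p, e p) :=
  basisMap_superpose _ _ _

lemma cnotTC_superpose (α : ι → ℂ) (h t c : ι → Fin (2 ^ u)) (e : ι → Fin n → Fin (2 ^ m)) :
    cnotTC (superpose α fun p => (h p, t p, c p, e p)) =
      superpose α fun p => (h p, t p, xorBits (c p) (t p), e p) :=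
  basisMap_superpose _ _ _

/-- Interference: indices with the same label contribute one basis vector, whose amplitude is the
sum of theirs. -/
lemma superpose_fiberwise [DecidableEq κ] (α : ι → ℂ) (f : ι → κ) (g : κ → Basis n m u) :
    superpose α (fun p => g (f p)) =
      superpose (fun e => ∑ p ∈ Finset.univ.filter (fun p => f p = e), α p) g := by
  simp only [superpose, Finset.sum_smul]
  rw [← Finset.sum_fiberwise Finset.univ f]
  refine Finset.sum_congr rfl fun e _ => Finset.sum_congr rfl fun p hp => ?_
  rw [(Finset.mem_filter.1 hp).2]

open Classical in
lemma prob_superpose (α : ι → ℂ) {g : ι → Basis n m u} (hg : Function.Injective g)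
    (P : Basis n m u → Prop) :
    prob (superpose α g) P = ∑ p, if P (g p) then ‖α p‖ ^ 2 else 0 := by
  rw [prob, ← Finset.sum_subset (Finset.subset_univ (Finset.univ.image g)),
    Finset.sum_image fun a _ b _ h => hg h]
  · simp only [superpose_apply_of_injective α hg]
  · intro b _ hb
    rw [superpose_apply_eq_zero]
    · simp
    · intro p hp
      exact hb (Finset.mem_image.2 ⟨p, Finset.mem_univ _, hp⟩)

open Classical in
lemma collapse_superpose (α : ι → ℂ) (g : ι → Basis n m u) (P : Basis n m u → Prop) :
    collapse P (superpose α g) =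
      superpose (fun p => if P (g p) then
        α p / (Real.sqrt (prob (superpose α g) P) : ℂ) else 0) g := by
  funext b
  simp only [collapse]
  generalize Real.sqrt (prob (superpose α g) P) = r
  simp only [superpose_apply]
  split_ifs with hb
  · rw [Finset.sum_div]
    refine Finset.sum_congr rfl fun p _ => ?_
    by_cases h : b = g p
    · subst h; simp [hb]
    · simp [h]
  · refine (Finset.sum_eq_zero fun p _ => ?_).symm
    by_cases h : b = g p
    · subst h; simp [hb]
    · simp [h]

lemma collapse_superpose_of_forall (α : ι → ℂ) (g : ι → Basis n m u) (P : Basis n m u → Prop)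
    (hP : ∀ p, P (g p)) (h : prob (superpose α g) P = 1) :
    collapse P (superpose α g) = superpose α g := by
  rw [collapse_superpose, h]
  simp [hP]

lemma onH_superpose (A : Matrix (Fin (2 ^ u)) (Fin (2 ^ u)) ℂ) (α : ι → ℂ)
    (h t c : ι → Fin (2 ^ u)) (e : ι → Fin n → Fin (2 ^ m)) :
    onH A (superpose α fun p => (h p, t p, c p, e p)) =
      superpose (fun p : Fin (2 ^ u) × ι => A p.1 (h p.2) * α p.2)
        (fun p => (p.1, t p.2, c p.2, e p.2)) := by
  funext ⟨h', t', c', e'⟩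
  simp only [onH, superpose_apply, Finset.mul_sum, Fintype.sum_prod_type, Prod.mk.injEq]
  refine Finset.sum_comm.trans (Eq.trans (Finset.sum_congr rfl fun p _ => ?_) Finset.sum_comm)
  -- The matrix leaves the other registers alone, so a mismatch there makes both sides vanish.
  by_cases hr : t' = t p ∧ c' = c p ∧ e' = e p
  · simp [hr]
  · have h1 : ∀ y : Fin (2 ^ u), ¬ (y = h p ∧ t' = t p ∧ c' = c p ∧ e' = e p) := fun y hy => hr ⟨hy.2.1, hy.2.2.1, hy.2.2.2⟩
    have h2 : ∀ y : Fin (2 ^ u), ¬ (h' = y ∧ t' = t p ∧ c' = c p ∧ e' = e p) := fun y hy => hr ⟨hy.2.1, hy.2.2.1, hy.2.2.2⟩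
    simp only [h1, h2, if_false, mul_zero, Finset.sum_const_zero]

lemma onT_superpose (A : Matrix (Fin (2 ^ u)) (Fin (2 ^ u)) ℂ) (α : ι → ℂ)
    (h t c : ι → Fin (2 ^ u)) (e : ι → Fin n → Fin (2 ^ m)) :
    onT A (superpose α fun p => (h p, t p, c p, e p)) =
      superpose (fun p : Fin (2 ^ u) × ι => A p.1 (t p.2) * α p.2)
        (fun p => (h p.2, p.1, c p.2, e p.2)) := by
  funext ⟨h', t', c', e'⟩
  simp only [onT, superpose_apply, Finset.mul_sum, Fintype.sum_prod_type, Prod.mk.injEq]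
  refine Finset.sum_comm.trans (Eq.trans (Finset.sum_congr rfl fun p _ => ?_) Finset.sum_comm)
  by_cases hr : h' = h p ∧ c' = c p ∧ e' = e p
  · simp [hr]
  · have h1 : ∀ y : Fin (2 ^ u), ¬ (h' = h p ∧ y = t p ∧ c' = c p ∧ e' = e p) := fun y hy => hr ⟨hy.1, hy.2.2.1, hy.2.2.2⟩
    have h2 : ∀ y : Fin (2 ^ u), ¬ (h' = h p ∧ t' = y ∧ c' = c p ∧ e' = e p) := fun y hy => hr ⟨hy.1, hy.2.2.1, hy.2.2.2⟩
    simp only [h1, h2, if_false, mul_zero, Finset.sum_const_zero]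

lemma onC_superpose (A : Matrix (Fin (2 ^ u)) (Fin (2 ^ u)) ℂ) (α : ι → ℂ)
    (h t c : ι → Fin (2 ^ u)) (e : ι → Fin n → Fin (2 ^ m)) :
    onC A (superpose α fun p => (h p, t p, c p, e p)) =
      superpose (fun p : Fin (2 ^ u) × ι => A p.1 (c p.2) * α p.2)
        (fun p => (h p.2, t p.2, p.1, e p.2)) := by
  funext ⟨h', t', c', e'⟩
  simp only [onC, superpose_apply, Finset.mul_sum, Fintype.sum_prod_type, Prod.mk.injEq]
  refine Finset.sum_comm.trans (Eq.trans (Finset.sum_congr rfl fun p _ => ?_) Finset.sum_comm)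
  by_cases hr : h' = h p ∧ t' = t p ∧ e' = e p
  · simp [hr]
  · have h1 : ∀ y : Fin (2 ^ u), ¬ (h' = h p ∧ t' = t p ∧ y = c p ∧ e' = e p) := fun y hy => hr ⟨hy.1, hy.2.1, hy.2.2.2⟩
    have h2 : ∀ y : Fin (2 ^ u), ¬ (h' = h p ∧ t' = t p ∧ c' = y ∧ e' = e p) := fun y hy => hr ⟨hy.1, hy.2.1, hy.2.2.2⟩
    simp only [h1, h2, if_false, mul_zero, Finset.sum_const_zero]

end superpose

/-! ### Closed forms of the states of the protocol -/

/-- The common amplitude of the uniform superposition of `2 ^ u` basis vectors. -/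
noncomputable def unif (u : ℕ) : ℂ := 1 / (Real.sqrt ((2 : ℝ) ^ u) : ℂ)

lemma unif_mul_unif (u : ℕ) : unif u * unif u = 1 / 2 ^ u := by
  rw [unif, div_mul_div_comm, one_mul, ← Complex.ofReal_mul, Real.mul_self_sqrt (by positivity)]
  simp

lemma norm_unif_sq (u : ℕ) : ‖unif u‖ ^ 2 = 1 / 2 ^ u := by
  rw [sq, ← norm_mul, unif_mul_unif]
  simp

lemma unif_div_sqrt (u : ℕ) : unif u / (Real.sqrt (1 / (2 : ℝ) ^ u) : ℂ) = 1 := by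
  have h : Real.sqrt ((2 : ℝ) ^ u) ≠ 0 := (Real.sqrt_pos.2 (by positivity)).ne'
  have h' : (Real.sqrt ((2 : ℝ) ^ u) : ℂ) ≠ 0 := by exact_mod_cast h
  rw [unif, Real.sqrt_div zero_le_one, Real.sqrt_one]
  push_cast
  field_simp

/-- The private registers when the parties below `s` have written the residues of `y`. -/
def memory (m : ℕ) (x : Fin n → ℕ) (s : ℕ) (y : Fin (2 ^ u)) : Fin n → Fin (2 ^ m) :=
  fun k => if k.val < s then residue m u (x k) y else zeroBits m

/-- The residues of `Z`, as `m`-bit strings. -/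
def residues (m : ℕ) (x : Fin n → ℕ) (Z : ℕ) : Fin n → Fin (2 ^ m) :=
  fun k => ⟨(Z % x k) % 2 ^ m, Nat.mod_lt _ (Nat.two_pow_pos m)⟩

lemma memory_full (x : Fin n → ℕ) (y : Fin (2 ^ u)) : memory m x n y = residues m x y := by
  funext k
  simp [memory, residues, residue]

lemma xorBits_zeroBits_left {q : ℕ} (a : Fin (2 ^ q)) : xorBits (zeroBits q) a = a := by
  ext; simp [xorBits, zeroBits]

lemma xorBits_self {q : ℕ} (a : Fin (2 ^ q)) : xorBits a a = zeroBits q := by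
  ext; simp [xorBits, zeroBits]

/-- Register `k` is still zero when party `k` acts, so the exclusive or simply writes the residue;
`t` is unchanged, so the same form is available to the next party. -/
lemma oracle_superpose {ι : Type*} [Fintype ι] (x : Fin n → ℕ) (k : Fin n) (α : ι → ℂ)
    (h t c : ι → Fin (2 ^ u)) :
    oracle x k (superpose α fun p => (h p, t p, c p, memory m x k (t p))) =
      superpose α fun p => (h p, t p, c p, memory m x (k + 1) (t p)) := by
  rw [oracle, basisMap_superpose]
  congr 1
  funext p
  refine Prod.ext rfl (Prod.ext rfl (Prod.ext rfl ?_))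
  funext j
  change Function.update (memory m x k (t p)) k (xorBits (memory m x k (t p) k)
    (residue m u (x k) (t p))) j = memory m x (k + 1) (t p) j
  by_cases hj : j = k
  · subst hj
    simp [memory, xorBits_zeroBits_left]
  · have : j.val ≠ k.val := fun h => hj (Fin.ext h)
    have h' : (j.val < k.val) = (j.val < k.val + 1) := propext (by omega)
    simp [Function.update_of_ne hj, memory, h']

lemma oraclesFrom_superpose {ι : Type*} [Fintype ι] (x : Fin n → ℕ) (s d : ℕ) (α : ι → ℂ)
    (h t c : ι → Fin (2 ^ u)) :
    oraclesFrom x s d (superpose α fun p => (h p, t p, c p, memory m x s (t p))) =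
      superpose α fun p => (h p, t p, c p, memory m x (s + d) (t p)) := by
  induction d with
  | zero => rfl
  | succ d ih =>
    rw [oraclesFrom, ih]
    split_ifs with hlt
    · exact oracle_superpose x ⟨s + d, hlt⟩ α h t c
    · congr 1
      funext p
      simp only [Prod.mk.injEq, true_and]
      funext k
      -- Here `s + d` is at least `n`, so every party lies below both thresholds.
      have := k.isLt
      simp only [memory]
      congr 1
      exact propext (by omega)

lemma hadamard_zeroBits (j : Fin (2 ^ u)) : hadamard u j (zeroBits u) = unif u := by
  simp [hadamard, zeroBits, unif]

lemma prepared_eq (x : Fin n → ℕ) :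
    (prepared : State n m u) =
      superpose (fun _ => unif u) fun y => (y, y, zeroBits u, memory m x 0 y) := by
  have hket : (ket (zeroBits u, zeroBits u, zeroBits u, fun _ => zeroBits m) : State n m u) =
      superpose (fun _ : Unit => 1) fun _ => (zeroBits u, zeroBits u, zeroBits u,
        fun _ => zeroBits m) := by
    simp [superpose]
  rw [prepared, hket, onH_superpose, cnotHT_superpose]
  simp only [superpose, Fintype.sum_prod_type, Finset.univ_unique, Finset.sum_singleton,
    hadamard_zeroBits, mul_one, xorBits_zeroBits_left]
  rfl

lemma stateAfter_eq (x : Fin n → ℕ) (s : ℕ) :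
    (stateAfter x s : State n m u) =
      superpose (fun _ => unif u) fun y => (y, y, zeroBits u, memory m x s y) := by
  rw [stateAfter, prepared_eq x]
  have := oraclesFrom_superpose (m := m) x 0 s (fun _ => unif u) (fun y : Fin (2 ^ u) => y)
    (fun y => y) (fun _ => zeroBits u)
  rwa [zero_add] at this

lemma uncomputed_eq (x : Fin n → ℕ) :
    (uncomputed x : State n m u) =
      superpose (fun _ => unif u) fun y => (y, zeroBits u, zeroBits u, residues m x y) := by
  rw [uncomputed, stateAfter_eq, cnotHT_superpose]
  simp only [xorBits_self, memory_full]

/-- The oracles read `t` without changing it, so the moment `s` of the copy leaves no trace in the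
result. -/
lemma uncomputedCopy_eq (x : Fin n → ℕ) {s : ℕ} (hs : s ≤ n) :
    (uncomputedCopy x s : State n m u) =
      superpose (fun _ => unif u) fun y => (y, zeroBits u, y, residues m x y) := by
  have h1 : cnotTC (stateAfter x s : State n m u) =
      superpose (fun _ => unif u) fun y => (y, y, y, memory m x s y) := by
    rw [stateAfter_eq, cnotTC_superpose]
    simp only [xorBits_zeroBits_left]
  have h2 := oraclesFrom_superpose (m := m) x s (n - s) (fun _ => unif u)
    (fun y : Fin (2 ^ u) => y) (fun y => y) (fun y => y)
  rw [uncomputedCopy, h1, h2, cnotHT_superpose, Nat.add_sub_cancel' hs]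
  simp only [xorBits_self, memory_full]

open Classical in
lemma prob_stateAfter (x : Fin n → ℕ) (s : ℕ) (P : Basis n m u → Prop) :
    prob (stateAfter x s) P =
      ∑ y : Fin (2 ^ u), if P (y, y, zeroBits u, memory m x s y) then (1 : ℝ) / 2 ^ u else 0 := by
  rw [stateAfter_eq, prob_superpose _ (fun a b h => (Prod.ext_iff.1 h).1)]
  simp only [norm_unif_sq]

open Classical in
lemma prob_uncomputed (x : Fin n → ℕ) (P : Basis n m u → Prop) :
    prob (uncomputed x) P = ∑ y : Fin (2 ^ u),
      if P (y, zeroBits u, zeroBits u, residues m x y) then (1 : ℝ) / 2 ^ u else 0 := by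
  rw [uncomputed_eq, prob_superpose _ (fun a b h => (Prod.ext_iff.1 h).1)]
  simp only [norm_unif_sq]

open Classical in
lemma prob_uncomputedCopy (x : Fin n → ℕ) {s : ℕ} (hs : s ≤ n) (P : Basis n m u → Prop) :
    prob (uncomputedCopy x s) P = ∑ y : Fin (2 ^ u),
      if P (y, zeroBits u, y, residues m x y) then (1 : ℝ) / 2 ^ u else 0 := by
  rw [uncomputedCopy_eq x hs, prob_superpose _ (fun a b h => (Prod.ext_iff.1 h).1)]
  simp only [norm_unif_sq]

lemma norm_phase (u : ℕ) (d : ℤ) : ‖phase u d‖ = 1 := by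
  have : 2 * (Real.pi : ℂ) * Complex.I * (d : ℂ) / (2 : ℂ) ^ u =
      ((2 * Real.pi * d / 2 ^ u : ℝ) : ℂ) * Complex.I := by
    push_cast; ring
  rw [phase, this, Complex.norm_exp_ofReal_mul_I]

lemma phase_add (u : ℕ) (d e : ℤ) : phase u (d + e) = phase u d * phase u e := by
  rw [phase, phase, phase, ← Complex.exp_add]
  congr 1
  push_cast
  ring

lemma qftInv_apply (j y : Fin (2 ^ u)) :
    qftInv u j y = phase u (-((y.val : ℤ) * (j.val : ℤ))) * unif u := by
  rw [qftInv, Matrix.of_apply, unif, mul_one_div]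

lemma qft_apply (j y : Fin (2 ^ u)) :
    qft u j y = phase u ((y.val : ℤ) * (j.val : ℤ)) * unif u := by
  rw [qft, Matrix.of_apply, unif, mul_one_div]

lemma norm_qftInv_mul_unif_sq (j y : Fin (2 ^ u)) :
    ‖qftInv u j y * unif u‖ ^ 2 = 1 / (2 ^ u) ^ 2 := by
  rw [qftInv_apply, mul_assoc, unif_mul_unif, norm_mul, norm_phase]
  simp

open Classical in
-- The transform removes `y` from `h`, but `t` still holds it: the labels stay distinct and the
-- phases are invisible.
lemma prob_onH_stateAfter (x : Fin n → ℕ) (s : ℕ) (P : Basis n m u → Prop) :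
    prob (onH (qftInv u) (stateAfter x s)) P =
      ∑ k : Fin (2 ^ u), ∑ y : Fin (2 ^ u),
        if P (k, y, zeroBits u, memory m x s y) then (1 : ℝ) / (2 ^ u) ^ 2 else 0 := by
  rw [stateAfter_eq, onH_superpose, prob_superpose]
  · simp only [norm_qftInv_mul_unif_sq, Fintype.sum_prod_type]
  · rintro ⟨k, y⟩ ⟨k', y'⟩ h
    simp only [Prod.mk.injEq] at h
    simp [h.1, h.2.1]

open Classical in
lemma prob_onT_stateAfter (x : Fin n → ℕ) (s : ℕ) (P : Basis n m u → Prop) :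
    prob (onT (qftInv u) (stateAfter x s)) P =
      ∑ k : Fin (2 ^ u), ∑ y : Fin (2 ^ u),
        if P (y, k, zeroBits u, memory m x s y) then (1 : ℝ) / (2 ^ u) ^ 2 else 0 := by
  rw [stateAfter_eq, onT_superpose, prob_superpose]
  · simp only [norm_qftInv_mul_unif_sq, Fintype.sum_prod_type]
  · rintro ⟨k, y⟩ ⟨k', y'⟩ h
    simp only [Prod.mk.injEq] at h
    simp [h.1, h.2.1]

lemma prob_uncomputed_regT (x : Fin n → ℕ) :
    prob (uncomputed x : State n m u) (fun w => regT w = zeroBits u) = 1 := by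
  rw [prob_uncomputed]
  simp

lemma prob_uncomputedCopy_regT (x : Fin n → ℕ) {s : ℕ} (hs : s ≤ n) :
    prob (uncomputedCopy x s : State n m u) (fun w => regT w = zeroBits u) = 1 := by
  rw [prob_uncomputedCopy x hs]
  simp

/-- No register outside the private ones holds `y` any more, so these labels need not be distinct.
-/
lemma final_eq (x : Fin n → ℕ) :
    (final x : State n m u) =
      superpose (fun p : Fin (2 ^ u) × Fin (2 ^ u) => qftInv u p.1 p.2 * unif u)
        fun p => (p.1, zeroBits u, zeroBits u, residues m x p.2) := by
  have h := prob_uncomputed_regT (m := m) (u := u) x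
  rw [final, checkAndTransform]
  rw [uncomputed_eq] at h ⊢
  rw [collapse_superpose_of_forall _ _ (fun b => regT b = zeroBits u) (fun _ => rfl) h,
    onH_superpose]

lemma finalCopy_eq (x : Fin n → ℕ) {s : ℕ} (hs : s ≤ n) :
    (finalCopy x s : State n m u) =
      superpose (fun p : Fin (2 ^ u) × Fin (2 ^ u) => qftInv u p.1 p.2 * unif u)
        fun p => (p.1, zeroBits u, p.2, residues m x p.2) := by
  have h := prob_uncomputedCopy_regT (m := m) (u := u) x hs
  rw [finalCopy, checkAndTransform]
  rw [uncomputedCopy_eq x hs] at h ⊢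
  rw [collapse_superpose_of_forall _ _ (fun b => regT b = zeroBits u) (fun _ => rfl) h,
    onH_superpose]

open Classical in
lemma prob_finalCopy (x : Fin n → ℕ) {s : ℕ} (hs : s ≤ n) (P : Basis n m u → Prop) :
    prob (finalCopy x s) P = ∑ k : Fin (2 ^ u), ∑ y : Fin (2 ^ u),
      if P (k, zeroBits u, y, residues m x y) then (1 : ℝ) / (2 ^ u) ^ 2 else 0 := by
  rw [finalCopy_eq x hs, prob_superpose]
  · simp only [norm_qftInv_mul_unif_sq, Fintype.sum_prod_type]
  · rintro ⟨k, y⟩ ⟨k', y'⟩ h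
    simp only [Prod.mk.injEq] at h
    simp [h.1, h.2.2.1]

lemma prob_finalCopy_regH (x : Fin n → ℕ) {s : ℕ} (hs : s ≤ n) (k : Fin (2 ^ u)) :
    prob (finalCopy x s : State n m u) (fun w => regH w = k) = 1 / 2 ^ u := by
  rw [prob_finalCopy x hs]
  simp [regH]
  field_simp

lemma attackedCopy_eq (x : Fin n → ℕ) {s : ℕ} (hs : s ≤ n) (k : Fin (2 ^ u)) :
    (attackedCopy x s k : State n m u) =
      superpose (fun p : Fin (2 ^ u) × Fin (2 ^ u) =>
          phase u ((p.2.val : ℤ) * ((p.1.val : ℤ) - k.val)) / 2 ^ u)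
        fun p => (k, zeroBits u, p.1, residues m x p.2) := by
  classical
  have h := prob_finalCopy_regH (m := m) x hs k
  have hc : collapse (fun b => regH b = k) (finalCopy x s : State n m u) =
      superpose (fun y : Fin (2 ^ u) => qftInv u k y) fun y => (k, zeroBits u, y,
        residues m x y) := by
    rw [finalCopy_eq x hs] at h ⊢
    rw [collapse_superpose, h]
    simp only [superpose, Fintype.sum_prod_type]
    -- Only the outcome `k` survives; dividing by the square root of its probability `1 / 2 ^ u`
    -- cancels one factor `unif u`.
    rw [Finset.sum_eq_single k]
    · simp only [if_true, mul_div_assoc, unif_div_sqrt, mul_one]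
    · intro k' _ hk
      simp [hk]
    · simp
  rw [attackedCopy, hc, onC_superpose]
  congr 1
  funext p
  simp only [qft_apply, qftInv_apply]
  rw [mul_mul_mul_comm, unif_mul_unif, ← phase_add, mul_one_div]
  congr 2
  ring

/-! Roots of unity. -/

lemma phase_nat_mul (u r : ℕ) (d : ℤ) : phase u ((r : ℤ) * d) = phase u d ^ r := by
  rw [phase, phase, ← Complex.exp_nat_mul]
  congr 1
  push_cast
  ring

lemma phase_eq_one_iff (u : ℕ) (d : ℤ) : phase u d = 1 ↔ (2 : ℤ) ^ u ∣ d := by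
  have h2 : (2 : ℂ) ^ u ≠ 0 := pow_ne_zero _ two_ne_zero
  have hpi : (Real.pi : ℂ) ≠ 0 := by exact_mod_cast Real.pi_ne_zero
  rw [phase, Complex.exp_eq_one_iff]
  constructor
  · rintro ⟨k, hk⟩
    refine ⟨k, ?_⟩
    have : (d : ℂ) = 2 ^ u * k := by
      have hI := Complex.I_ne_zero
      field_simp at hk
      linear_combination hk
    exact_mod_cast this
  · rintro ⟨k, rfl⟩
    refine ⟨k, ?_⟩
    push_cast
    field_simp

lemma phase_neg (u : ℕ) (d : ℤ) : phase u (-d) = (starRingEnd ℂ) (phase u d) := by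
  rw [phase, phase, ← Complex.exp_conj]
  congr 1
  have h2 : (starRingEnd ℂ) 2 = 2 := map_ofNat _ 2
  simp [h2, neg_div]

lemma sum_pow_of_pow_eq_one {r : ℂ} {M : ℕ} (h : r ^ M = 1) :
    ∑ i ∈ Finset.range M, r ^ i = if r = 1 then (M : ℂ) else 0 := by
  split_ifs with hr
  · simp [hr]
  · have := mul_neg_geom_sum r M
    rw [h, sub_self] at this
    exact (mul_eq_zero.1 this).resolve_left (sub_ne_zero.2 (Ne.symm hr))

lemma sum_phase (u : ℕ) (d : ℤ) :
    ∑ k : Fin (2 ^ u), phase u ((k.val : ℤ) * d) = if (2 : ℤ) ^ u ∣ d then (2 : ℂ) ^ u else 0 := by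
  have h : phase u d ^ (2 ^ u) = 1 := by
    rw [← phase_nat_mul, phase_eq_one_iff]
    exact ⟨d, by push_cast; ring⟩
  simp only [phase_nat_mul]
  rw [Fin.sum_univ_eq_sum_range (fun k => phase u d ^ k), sum_pow_of_pow_eq_one h]
  simp [phase_eq_one_iff]

/-- Expanding the square and summing over `k` first leaves only the diagonal, because distinct
elements of `S` are incongruent modulo `2 ^ u`. -/
lemma parseval (S : Finset ℕ) (hS : S ⊆ Finset.range (2 ^ u)) (l : ℤ) :
    ∑ k : Fin (2 ^ u), ‖∑ j ∈ S, phase u ((j : ℤ) * (l - k.val))‖ ^ 2 = 2 ^ u * S.card := by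
  have key : ∀ j ∈ S, ∀ j' ∈ S,
      ∑ k : Fin (2 ^ u), phase u ((j : ℤ) * (l - k.val)) * phase u (-((j' : ℤ) * (l - k.val))) =
        if j = j' then (2 : ℂ) ^ u else 0 := by
    intro j hj j' hj'
    have h1 : ∀ k : Fin (2 ^ u),
        phase u ((j : ℤ) * (l - k.val)) * phase u (-((j' : ℤ) * (l - k.val))) =
          phase u (((j : ℤ) - j') * l) * phase u ((k.val : ℤ) * ((j' : ℤ) - j)) := by
      intro k
      rw [← phase_add, ← phase_add]
      congr 1
      ring
    simp only [h1, ← Finset.mul_sum, sum_phase]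
    split_ifs with hd he he
    · subst he
      have : phase u (((j : ℤ) - j) * l) = 1 := (phase_eq_one_iff _ _).2 (by simp)
      rw [this, one_mul]
    · exfalso
      have hj2 := Finset.mem_range.1 (hS hj)
      have hj2' := Finset.mem_range.1 (hS hj')
      apply he
      have := Int.eq_zero_of_abs_lt_dvd hd (by
        rw [abs_lt]; constructor <;> zify at hj2 hj2' <;> linarith)
      omega
    · exact absurd (by subst he; simp) hd
    · simp
  have hC : ((∑ k : Fin (2 ^ u), ‖∑ j ∈ S, phase u ((j : ℤ) * (l - k.val))‖ ^ 2 : ℝ) : ℂ) =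
      ((2 ^ u * S.card : ℝ) : ℂ) := by
    push_cast
    simp only [← Complex.mul_conj', map_sum, ← phase_neg, Finset.sum_mul_sum]
    rw [Finset.sum_comm]
    rw [Finset.sum_congr rfl fun j hj => Finset.sum_comm]
    rw [Finset.sum_congr rfl fun j hj => Finset.sum_congr rfl fun j' hj' => key j hj j' hj']
    simp [mul_comm]
  exact_mod_cast hC

lemma classWeight_neg (u T Z : ℕ) (d : ℤ) : classWeight u T Z (-d) = classWeight u T Z d := by
  rw [classWeight, classWeight]
  simp only [mul_neg, phase_neg, ← map_sum, RCLike.norm_conj]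

lemma sum_classWeight_sub (u T Z : ℕ) (l : ℤ) :
    ∑ k : Fin (2 ^ u), classWeight u T Z (l - k.val) = residueFreq u T Z := by
  simp only [classWeight, ← Finset.sum_div]
  rw [parseval _ (Finset.filter_subset _ _), residueFreq]
  field_simp

lemma sum_classWeight (u T Z : ℕ) :
    ∑ k : Fin (2 ^ u), classWeight u T Z k.val = residueFreq u T Z := by
  rw [← sum_classWeight_sub u T Z 0]
  simp only [zero_sub, classWeight_neg]

/-! Counting residues. -/

/-- As `a` divides `T`, a class modulo `a` is a disjoint union of classes modulo `T`. -/
lemma sum_residueFreq {a T : ℕ} (hT : 0 < T) (h : a ∣ T) (u Y : ℕ) :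
    ∑ Z ∈ (Finset.range T).filter (fun Z => Z % a = Y), residueFreq u T Z = residueFreq u a Y := by
  simp only [residueFreq, ← Finset.sum_div, ← Nat.cast_sum]
  congr 2
  rw [Finset.card_eq_sum_card_fiberwise (f := fun j => j % T)
    (t := (Finset.range T).filter (fun Z => Z % a = Y))]
  · refine Finset.sum_congr rfl fun Z hZ => ?_
    congr 1
    ext j
    simp only [Finset.mem_filter, Finset.mem_range] at hZ ⊢
    constructor
    · rintro ⟨hj, rfl⟩
      rw [Nat.mod_mod_of_dvd _ h] at hZ
      exact ⟨⟨hj, hZ.2⟩, rfl⟩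
    · rintro ⟨⟨hj, -⟩, hjZ⟩
      exact ⟨hj, hjZ⟩
  · intro j hj
    simp only [Finset.coe_filter, Finset.mem_range, Set.mem_ofPred_eq] at hj ⊢
    exact ⟨Nat.mod_lt _ hT, by rw [Nat.mod_mod_of_dvd _ h]; exact hj.2⟩

lemma sum_residueFreq_range {T : ℕ} (hT : 0 < T) (u : ℕ) :
    ∑ Z ∈ Finset.range T, residueFreq u T Z = 1 := by
  have := sum_residueFreq hT (one_dvd T) u 0
  simp only [Nat.mod_one, Finset.filter_true] at this
  rw [this, residueFreq]
  simp [Nat.mod_one]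

/-- The right side is the ceiling of `(N - Y) / a`, arranged so that no truncated subtraction
involves `N`. -/
lemma card_filter_mod {a Y : ℕ} (hY : Y < a) (N : ℕ) :
    ((Finset.range N).filter (fun j => j % a = Y)).card = (N + (a - 1 - Y)) / a := by
  have ha : 0 < a := by omega
  have h := Nat.count_modEq_card N ha Y
  rw [Nat.count_eq_card_filter_range] at h
  have h2 : ((Finset.range N).filter (fun j => j % a = Y)) =
      ((Finset.range N).filter (fun j => j ≡ Y [MOD a])) := by
    ext j; simp [Nat.ModEq, Nat.mod_eq_of_lt hY]
  rw [h2, h, Nat.mod_eq_of_lt hY]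
  have hN := Nat.div_add_mod N a
  have hlt := Nat.mod_lt N ha
  set q := N / a
  set r := N % a
  rw [← hN, add_assoc, Nat.mul_add_div ha]
  congr 1
  split_ifs with hr
  · symm; rw [Nat.div_eq_iff ha]; omega
  · symm; rw [Nat.div_eq_iff ha]; omega

lemma abs_residueFreq_sub_lt {a Y : ℕ} (hY : Y < a) (u : ℕ) :
    |residueFreq u a Y - 1 / a| < 1 / 2 ^ u := by
  have ha : 0 < a := by omega
  have haR : (0 : ℝ) < a := by exact_mod_cast ha
  rw [residueFreq, card_filter_mod hY]
  set c := (2 ^ u + (a - 1 - Y)) / a with hc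
  have h1 : c * a ≤ 2 ^ u + (a - 1 - Y) := Nat.div_mul_le_self _ _
  have h2 : 2 ^ u + (a - 1 - Y) < (c + 1) * a := by
    rw [add_mul, one_mul, mul_comm]; exact Nat.lt_mul_div_succ _ ha
  -- The two bounds on the quotient put `c * a` strictly within `a` of `2 ^ u`; dividing by `2 ^ u *
  -- a` gives the claim.
  have h3 : c * a < 2 ^ u + a := by omega
  have h4 : 2 ^ u < c * a + a := by rw [← Nat.succ_mul]; exact lt_of_le_of_lt (by omega) h2
  have h3' : (c : ℝ) * a < 2 ^ u + a := by exact_mod_cast h3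
  have h4' : (2 : ℝ) ^ u < c * a + a := by exact_mod_cast h4
  have hp : (0 : ℝ) < 2 ^ u := by positivity
  have : (c : ℝ) / 2 ^ u - 1 / a = (c * a - 2 ^ u) / (2 ^ u * a) := by field_simp
  rw [this, abs_div, abs_of_pos (mul_pos hp haR), div_lt_div_iff₀ (mul_pos hp haR) hp, one_mul,
    mul_comm]
  exact mul_lt_mul_of_pos_left (abs_lt.2 ⟨by linarith, by linarith⟩) hp

lemma residueFreq_of_dvd {a Y : ℕ} (hY : Y < a) {u : ℕ} (h : a ∣ 2 ^ u) :
    residueFreq u a Y = 1 / a := by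
  have ha : 0 < a := by omega
  have haR : (0 : ℝ) < a := by exact_mod_cast ha
  rw [residueFreq, card_filter_mod hY]
  obtain ⟨q, hq⟩ := h
  have hqR : (2 : ℝ) ^ u = a * q := by exact_mod_cast hq
  have hq0 : (q : ℝ) ≠ 0 := by
    rintro h0; rw [h0, mul_zero] at hqR; exact absurd hqR (by positivity)
  rw [hq, Nat.mul_add_div ha, Nat.div_eq_of_lt (by omega : a - 1 - Y < a), add_zero, hqR]
  field_simp

lemma filter_mod_eq_image {T M Z : ℕ} (hZ : Z < T) :
    (Finset.range (T * M)).filter (fun j => j % T = Z) =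
      (Finset.range M).image (fun r => T * r + Z) := by
  ext j
  simp only [Finset.mem_filter, Finset.mem_range, Finset.mem_image]
  constructor
  · rintro ⟨hj, rfl⟩
    exact ⟨j / T, Nat.div_lt_of_lt_mul hj, Nat.div_add_mod j T⟩
  · rintro ⟨r, hr, rfl⟩
    refine ⟨?_, by rw [Nat.mul_add_mod, Nat.mod_eq_of_lt hZ]⟩
    calc T * r + Z < T * r + T := by omega
      _ = T * (r + 1) := by ring
      _ ≤ T * M := Nat.mul_le_mul_left _ hr

/-- With `M = 2 ^ u / T`, the class is the progression `T * r + Z` for `r < M`. Up to a phase its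
sum is geometric, with an `M`-th root of unity as ratio, and this ratio is `1` exactly when `M`
divides `d`. -/
lemma classWeight_of_dvd {T Z : ℕ} (hZ : Z < T) {u : ℕ} (h : T ∣ 2 ^ u) (d : ℤ) :
    classWeight u T Z d = if ((2 ^ u / T : ℕ) : ℤ) ∣ d then 1 / (T : ℝ) ^ 2 else 0 := by
  have hT : 0 < T := by omega
  obtain ⟨M, hM⟩ := h
  have hM0 : 0 < M := Nat.pos_of_ne_zero (by
    rintro rfl; exact absurd hM (by positivity))
  rw [classWeight, hM, filter_mod_eq_image hZ, Finset.sum_image, Nat.mul_div_cancel_left _ hT]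
  · have h1 : ∀ r : ℕ, phase u (((T * r + Z : ℕ) : ℤ) * d) =
        phase u ((Z : ℤ) * d) * phase u ((T : ℤ) * d) ^ r := by
      intro r
      rw [← phase_nat_mul, ← phase_add]
      congr 1
      push_cast
      ring
    have hM' : (2 : ℤ) ^ u = T * M := by exact_mod_cast hM
    have hMR : (2 : ℝ) ^ u = T * M := by exact_mod_cast hM
    have h2 : phase u ((T : ℤ) * d) ^ M = 1 := by
      rw [← phase_nat_mul, phase_eq_one_iff]
      exact ⟨d, by rw [hM']; ring⟩
    have h3 : phase u ((T : ℤ) * d) = 1 ↔ (M : ℤ) ∣ d := by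
      rw [phase_eq_one_iff, hM']
      exact mul_dvd_mul_iff_left (by exact_mod_cast hT.ne')
    simp only [h1, ← Finset.mul_sum, sum_pow_of_pow_eq_one h2, h3, hMR]
    split_ifs
    · rw [norm_mul, norm_phase, one_mul, Complex.norm_natCast]
      have : (T : ℝ) ≠ 0 := by exact_mod_cast hT.ne'
      have : (M : ℝ) ≠ 0 := by exact_mod_cast hM0.ne'
      field_simp
    · simp
  · intro a _ b _ hab
    exact Nat.eq_of_mul_eq_mul_left hT (Nat.add_right_cancel hab)

lemma sum_classWeight_range_of_dvd {T : ℕ} (hT : 0 < T) {u : ℕ} (h : T ∣ 2 ^ u) (d : ℤ) :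
    ∑ Z ∈ Finset.range T, classWeight u T Z d =
      if ((2 ^ u / T : ℕ) : ℤ) ∣ d then 1 / (T : ℝ) else 0 := by
  rw [Finset.sum_congr rfl fun Z hZ => classWeight_of_dvd (Finset.mem_range.1 hZ) h d]
  have : (T : ℝ) ≠ 0 := by exact_mod_cast hT.ne'
  split_ifs
  · simp
    field_simp
  · simp

/-- There are `T / a` classes, each of weight `1 / T ^ 2`. In the product form, `1 / T` is the
probability of the outcome of `h` and `1 / a` the conditional one. -/
lemma sum_classWeight_filter_of_dvd {a T Y : ℕ} (hT : 0 < T) (ha : a ∣ T) (hY : Y < a) {u : ℕ}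
    (h : T ∣ 2 ^ u) {d : ℤ} (hd : ((2 ^ u / T : ℕ) : ℤ) ∣ d) :
    ∑ Z ∈ (Finset.range T).filter (fun Z => Z % a = Y), classWeight u T Z d =
      1 / (T : ℝ) * (1 / a) := by
  rw [Finset.sum_congr rfl fun Z hZ => (classWeight_of_dvd
    (Finset.mem_range.1 (Finset.mem_filter.1 hZ).1) h d).trans (if_pos hd), Finset.sum_const,
    card_filter_mod hY]
  obtain ⟨q, rfl⟩ := ha
  have ha : 0 < a := by omega
  have hq : 0 < q := Nat.pos_of_mul_pos_left hT
  have : (a : ℝ) ≠ 0 := by exact_mod_cast ha.ne'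
  have : (q : ℝ) ≠ 0 := by exact_mod_cast hq.ne'
  rw [Nat.mul_add_div ha, Nat.div_eq_of_lt (by omega : a - 1 - Y < a), add_zero]
  push_cast
  rw [nsmul_eq_mul]
  field_simp

lemma exists_shift_iff {T u : ℕ} (hT : 0 < T) (h : T ∣ 2 ^ u) {k l : ℕ}
    (hk : k < 2 ^ u) (hl : l < 2 ^ u) :
    (∃ r < T, l = (k + r * (2 ^ u / T)) % 2 ^ u) ↔
      ((2 ^ u / T : ℕ) : ℤ) ∣ (l : ℤ) - k := by
  obtain ⟨M, hM⟩ := h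
  rw [hM] at hk hl
  rw [hM, Nat.mul_div_cancel_left _ hT, ← Nat.modEq_iff_dvd]
  have hMN : M ∣ T * M := Dvd.intro_left T rfl
  constructor
  · rintro ⟨r, -, hl⟩
    rw [hl, Nat.ModEq, Nat.mod_mod_of_dvd _ hMN, Nat.add_mul_mod_self_right]
  · intro hkl
    rcases le_total k l with hle | hle
    · obtain ⟨r, hr⟩ := (Nat.modEq_iff_dvd' hle).1 hkl
      have hlr : l = k + r * M := by rw [mul_comm r]; omega
      refine ⟨r, ?_, by rw [← hlr, Nat.mod_eq_of_lt hl]⟩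
      exact Nat.lt_of_mul_lt_mul_right (a := M) (by omega)
    · obtain ⟨r, hr⟩ := (Nat.modEq_iff_dvd' hle).1 hkl.symm
      -- Going down by `r` steps is going up by `T - r` around the cycle; `r = 0` is separate since
      -- the shift must be less than `T`.
      rcases Nat.eq_zero_or_pos r with rfl | hr0
      · exact ⟨0, hT, by rw [zero_mul, add_zero, Nat.mod_eq_of_lt hk]; omega⟩
      · have hrT : r < T := by
          refine Nat.lt_of_mul_lt_mul_right (a := M) ?_
          rw [mul_comm r]; omega
        refine ⟨T - r, by omega, ?_⟩
        have h5 : (T - r) * M + r * M = T * M := by rw [← add_mul, Nat.sub_add_cancel hrT.le]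
        have : k + (T - r) * M = l + T * M := by rw [mul_comm M] at hr; omega
        rw [this, Nat.add_mod_right, Nat.mod_eq_of_lt hl]

/-! ### Interference inside residue classes -/

lemma regE_mk (a b c : Fin (2 ^ u)) (e : Fin n → Fin (2 ^ m)) (i : Fin n) :
    regE ((a, b, c, e) : Basis n m u) i = e i := rfl

lemma residues_apply_eq_iff {x : Fin n → ℕ} {i : Fin n} (hx : 0 < x i ∧ x i < 2 ^ m) (Z : ℕ)
    (Y : Fin (2 ^ m)) : residues m x Z i = Y ↔ Z % x i = Y.val := by
  rw [Fin.ext_iff]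
  change Z % x i % 2 ^ m = Y.val ↔ _
  rw [Nat.mod_eq_of_lt ((Nat.mod_lt _ hx.1).trans hx.2)]

/-- All residues agree when every `x k` divides the difference, that is, when the least common
multiple does. The bound by `2 ^ m` ensures that no residue is cut off. -/
lemma residues_eq_iff {x : Fin n → ℕ} (hx : ∀ k, 0 < x k ∧ x k < 2 ^ m) (Z Z' : ℕ) :
    residues m x Z = residues m x Z' ↔ Z ≡ Z' [MOD Finset.univ.lcm x] := by
  have h : ∀ k, residues m x Z k = residues m x Z' k ↔ Z ≡ Z' [MOD x k] := by
    intro k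
    rw [residues_apply_eq_iff (hx k)]
    change Z % x k = Z' % x k % 2 ^ m ↔ _
    rw [Nat.mod_eq_of_lt ((Nat.mod_lt _ (hx k).1).trans (hx k).2)]
    rfl
  rw [funext_iff]
  simp only [h, Nat.modEq_iff_dvd, Int.natCast_dvd, Finset.lcm_dvd_iff, Finset.mem_univ,
    forall_true_left]

lemma lcm_pos {x : Fin n → ℕ} (hx : ∀ k, 0 < x k) : 0 < Finset.univ.lcm x := by
  refine Nat.pos_of_ne_zero fun h => ?_
  obtain ⟨k, -, hk⟩ := Finset.lcm_eq_zero_iff.1 h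
  exact (hx k).ne' hk

open Classical in
-- Private contents that are not the residues of any `Z` have an empty fibre, and the residue map is
-- injective on the numbers below the least common multiple.
lemma sum_residues_fiberwise {x : Fin n → ℕ} (hx : ∀ k, 0 < x k ∧ x k < 2 ^ m)
    (β : Fin (2 ^ u) → ℂ) (P : (Fin n → Fin (2 ^ m)) → Prop) :
    (∑ e, if P e then
        ‖∑ y ∈ Finset.univ.filter (fun y : Fin (2 ^ u) => residues m x y = e), β y‖ ^ 2 else 0) =
      ∑ Z ∈ Finset.range (Finset.univ.lcm x), if P (residues m x Z) then
        ‖∑ y ∈ Finset.univ.filter (fun y : Fin (2 ^ u) => y.val % Finset.univ.lcm x = Z),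
          β y‖ ^ 2 else 0 := by
  have hT := lcm_pos fun k => (hx k).1
  have hinj : Set.InjOn (residues m x) (Finset.range (Finset.univ.lcm x)) := by
    intro Z hZ Z' hZ' h
    have := (residues_eq_iff hx Z Z').1 h
    rwa [Nat.ModEq, Nat.mod_eq_of_lt (Finset.mem_range.1 hZ),
      Nat.mod_eq_of_lt (Finset.mem_range.1 hZ')] at this
  rw [← Finset.sum_subset
    (Finset.subset_univ ((Finset.range (Finset.univ.lcm x)).image (residues m x))),
    Finset.sum_image hinj]
  · refine Finset.sum_congr rfl fun Z hZ => ?_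
    simp only [residues_eq_iff hx, Nat.ModEq, Nat.mod_eq_of_lt (Finset.mem_range.1 hZ)]
  · intro e _ he
    rw [Finset.filter_false_of_mem]
    · simp
    · intro y _ hy
      refine he (Finset.mem_image.2
        ⟨y.val % Finset.univ.lcm x, Finset.mem_range.2 (Nat.mod_lt _ hT), ?_⟩)
      rw [← hy, residues_eq_iff hx]
      exact Nat.mod_modEq _ _

open Classical in
-- The index `k` is visible in `h`, `t`, `c`, so it does not interfere; `y` is visible only through
-- its residues, so it interferes within its class.
lemma prob_superpose_residues {κ : Type*} [Fintype κ] {x : Fin n → ℕ}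
    (hx : ∀ k, 0 < x k ∧ x k < 2 ^ m) (α : κ × Fin (2 ^ u) → ℂ) (h t c : κ → Fin (2 ^ u))
    (hinj : ∀ k k', h k = h k' → t k = t k' → c k = c k' → k = k') (P : Basis n m u → Prop) :
    prob (superpose α fun p => (h p.1, t p.1, c p.1, residues m x p.2)) P =
      ∑ k, ∑ Z ∈ Finset.range (Finset.univ.lcm x),
        if P (h k, t k, c k, residues m x Z) then
          ‖∑ y ∈ Finset.univ.filter (fun y : Fin (2 ^ u) => y.val % Finset.univ.lcm x = Z),
            α (k, y)‖ ^ 2 else 0 := by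
  have hs := superpose_fiberwise α (fun p : κ × Fin (2 ^ u) => (p.1, residues m x p.2))
    (fun q => ((h q.1, t q.1, c q.1, q.2) : Basis n m u))
  rw [hs, prob_superpose]
  · rw [Fintype.sum_prod_type]
    refine Finset.sum_congr rfl fun k _ => ?_
    rw [← sum_residues_fiberwise hx (fun y => α (k, y)) fun e => P (h k, t k, c k, e)]
    refine Finset.sum_congr rfl fun e _ => ?_
    congr 3
    simp only [Finset.sum_filter, Fintype.sum_prod_type, Prod.mk.injEq]
    rw [Finset.sum_eq_single k]
    · simp
    · intro k' _ hk
      simp [hk]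
    · simp
  · rintro ⟨k, e⟩ ⟨k', e'⟩ hkk
    simp only [Prod.mk.injEq] at hkk
    exact Prod.ext (hinj _ _ hkk.1 hkk.2.1 hkk.2.2.1) hkk.2.2.2

lemma norm_sum_phase_div_sq (T Z : ℕ) (d : ℤ) :
    ‖∑ y ∈ Finset.univ.filter (fun y : Fin (2 ^ u) => y.val % T = Z),
      phase u ((y.val : ℤ) * d) / 2 ^ u‖ ^ 2 = classWeight u T Z d := by
  rw [← Finset.sum_div, norm_div, div_pow, norm_pow, Complex.norm_ofNat, classWeight,
    Finset.sum_filter, Finset.sum_filter,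
    Fin.sum_univ_eq_sum_range (fun j => if j % T = Z then phase u ((j : ℤ) * d) else 0)]

open Classical in
lemma prob_final {x : Fin n → ℕ} (hx : ∀ k, 0 < x k ∧ x k < 2 ^ m) (P : Basis n m u → Prop) :
    prob (final x) P = ∑ k : Fin (2 ^ u), ∑ Z ∈ Finset.range (Finset.univ.lcm x),
      if P (k, zeroBits u, zeroBits u, residues m x Z) then
        classWeight u (Finset.univ.lcm x) Z k.val else 0 := by
  rw [final_eq, prob_superpose_residues hx _ (fun k => k) (fun _ => zeroBits u)
    (fun _ => zeroBits u) fun _ _ h _ _ => h]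
  have h : ∀ k y : Fin (2 ^ u), qftInv u k y * unif u =
      phase u ((y.val : ℤ) * (-(k.val : ℤ))) / 2 ^ u := by
    intro k y
    rw [qftInv_apply, mul_assoc, unif_mul_unif, mul_one_div, mul_neg]
  simp only [h, norm_sum_phase_div_sq, classWeight_neg]

open Classical in
lemma prob_attackedCopy {x : Fin n → ℕ} (hx : ∀ k, 0 < x k ∧ x k < 2 ^ m) {s : ℕ} (hs : s ≤ n)
    (k : Fin (2 ^ u)) (P : Basis n m u → Prop) :
    prob (attackedCopy x s k) P = ∑ l : Fin (2 ^ u), ∑ Z ∈ Finset.range (Finset.univ.lcm x),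
      if P (k, zeroBits u, l, residues m x Z) then
        classWeight u (Finset.univ.lcm x) Z ((l.val : ℤ) - k.val) else 0 := by
  rw [attackedCopy_eq x hs, prob_superpose_residues hx _ (fun _ => k) (fun _ => zeroBits u)
    (fun l => l) fun _ _ _ _ h => h]
  simp only [norm_sum_phase_div_sq]

/-! ### Outcome probabilities at the end of the protocol -/

lemma prob_nonneg (ψ : State n m u) (P : Basis n m u → Prop) : 0 ≤ prob ψ P :=
  Finset.sum_nonneg fun b _ => by split_ifs <;> positivity

/-- This covers an outcome `Q` of probability zero too: division by zero makes both sides zero. -/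
lemma prob_collapse (ψ : State n m u) (P Q : Basis n m u → Prop) :
    prob (collapse Q ψ) P = prob ψ (fun b => Q b ∧ P b) / prob ψ Q := by
  classical
  rw [prob, prob, Finset.sum_div]
  refine Finset.sum_congr rfl fun b _ => ?_
  by_cases hP : P b <;> by_cases hQ : Q b <;>
    simp [collapse, hP, hQ, div_pow, Real.sq_sqrt (prob_nonneg ψ Q)]

lemma sum_ite_mod_eq_residueFreq (u a Y : ℕ) :
    (∑ y : Fin (2 ^ u), if y.val % a = Y then (1 : ℝ) / 2 ^ u else 0) = residueFreq u a Y := by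
  rw [Fin.sum_univ_eq_sum_range (fun j => if j % a = Y then (1 : ℝ) / 2 ^ u else 0),
    ← Finset.sum_filter, Finset.sum_const, residueFreq, nsmul_eq_mul, mul_one_div]

lemma prob_final_regH_regE {x : Fin n → ℕ} (hx : ∀ k, 0 < x k ∧ x k < 2 ^ m) (i : Fin n)
    (k : Fin (2 ^ u)) (Y : Fin (2 ^ m)) :
    prob (final x) (fun w => regH w = k ∧ regE w i = Y) =
      ∑ Z ∈ (Finset.range (Finset.univ.lcm x)).filter (fun Z => Z % x i = Y.val),
        classWeight u (Finset.univ.lcm x) Z k.val := by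
  rw [prob_final hx, Finset.sum_eq_single k]
  · rw [Finset.sum_filter]
    simp only [regE, true_and, residues_apply_eq_iff (hx i)]
  · intro k' _ hk
    simp [hk]
  · simp

lemma prob_final_regH {x : Fin n → ℕ} (hx : ∀ k, 0 < x k ∧ x k < 2 ^ m) (k : Fin (2 ^ u)) :
    prob (final (m := m) x) (fun w => regH w = k) =
      ∑ Z ∈ Finset.range (Finset.univ.lcm x), classWeight u (Finset.univ.lcm x) Z k.val := by
  rw [prob_final hx, Finset.sum_eq_single k]
  · simp
  · intro k' _ hk
    simp [hk]
  · simp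

/-- By Parseval, summing over `k` turns each weight into the frequency of its class modulo `T`;
these classes then merge into one class modulo `x i`. -/
lemma prob_final_regE {x : Fin n → ℕ} (hx : ∀ k, 0 < x k ∧ x k < 2 ^ m) (i : Fin n)
    (Y : Fin (2 ^ m)) :
    prob (final (u := u) x) (fun w => regE w i = Y) = residueFreq u (x i) Y := by
  rw [prob_final hx, Finset.sum_comm,
    ← sum_residueFreq (T := Finset.univ.lcm x) (lcm_pos fun k => (hx k).1)
      (Finset.dvd_lcm (Finset.mem_univ i)),
    Finset.sum_filter]
  refine Finset.sum_congr rfl fun Z _ => ?_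
  simp only [regE, residues_apply_eq_iff (hx i)]
  split_ifs
  · exact sum_classWeight _ _ _
  · simp

lemma prob_attackedCopy_regC {x : Fin n → ℕ} (hx : ∀ k, 0 < x k ∧ x k < 2 ^ m) {s : ℕ}
    (hs : s ≤ n) (k l : Fin (2 ^ u)) :
    prob (attackedCopy (m := m) x s k) (fun w => regC w = l) =
      ∑ Z ∈ Finset.range (Finset.univ.lcm x),
        classWeight u (Finset.univ.lcm x) Z ((l.val : ℤ) - k.val) := by
  rw [prob_attackedCopy hx hs, Finset.sum_eq_single l]
  · simp
  · intro l' _ hl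
    simp [hl]
  · simp

lemma prob_afterPeriodFinding_of_dvd {x : Fin n → ℕ} (hx : ∀ k, 0 < x k ∧ x k < 2 ^ m)
    (i : Fin n) (hT : Finset.univ.lcm x ∣ 2 ^ u) {k : Fin (2 ^ u)}
    (hk : 2 ^ u / Finset.univ.lcm x ∣ k.val) {Y : Fin (2 ^ m)} (hY : Y.val < x i) :
    prob (afterPeriodFinding x k) (fun w => regE w i = Y) = 1 / x i := by
  have hpos := lcm_pos fun k => (hx k).1
  have hpos' : ((Finset.univ.lcm x : ℕ) : ℝ) ≠ 0 := by exact_mod_cast hpos.ne'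
  have hk' := Int.natCast_dvd_natCast.2 hk
  rw [afterPeriodFinding, prob_collapse, prob_final_regH_regE hx, prob_final_regH hx,
    sum_classWeight_range_of_dvd hpos hT, if_pos hk',
    sum_classWeight_filter_of_dvd hpos (Finset.dvd_lcm (Finset.mem_univ i)) hY hT hk']
  exact mul_div_cancel_left₀ _ (one_div_ne_zero hpos')

/-! The distributions seen by an attacker depend on the inputs of the others only through the
least common multiple. -/

section view

variable {x x' : Fin n → ℕ} {i : Fin n}

lemma memory_apply_congr (hi : x' i = x i) (s : ℕ) (y : Fin (2 ^ u)) :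
    memory m x' s y i = memory m x s y i := by
  simp only [memory, hi]

lemma residues_apply_congr (hi : x' i = x i) (Z : ℕ) :
    residues m x' Z i = residues m x Z i := by
  simp only [residues, hi]

lemma view_stateAfter_congr (hi : x' i = x i) (s : ℕ) (a b c : Fin (2 ^ u)) (Y : Fin (2 ^ m)) :
    view i (stateAfter x' s) a b c Y = view i (stateAfter x s) a b c Y := by
  simp only [view, prob_stateAfter, regH, regT, regC, regE_mk,
    memory_apply_congr hi]
  congr!

lemma view_onH_stateAfter_congr (hi : x' i = x i) (s : ℕ) (a b c : Fin (2 ^ u))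
    (Y : Fin (2 ^ m)) :
    view i (onH (qftInv u) (stateAfter x' s)) a b c Y =
      view i (onH (qftInv u) (stateAfter x s)) a b c Y := by
  simp only [view, prob_onH_stateAfter, regH, regT, regC, regE_mk,
    memory_apply_congr hi]
  congr!

lemma view_onT_stateAfter_congr (hi : x' i = x i) (s : ℕ) (a b c : Fin (2 ^ u))
    (Y : Fin (2 ^ m)) :
    view i (onT (qftInv u) (stateAfter x' s)) a b c Y =
      view i (onT (qftInv u) (stateAfter x s)) a b c Y := by
  simp only [view, prob_onT_stateAfter, regH, regT, regC, regE_mk,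
    memory_apply_congr hi]
  congr!

lemma view_uncomputed_congr (hi : x' i = x i) (a b c : Fin (2 ^ u)) (Y : Fin (2 ^ m)) :
    view i (uncomputed x') a b c Y = view i (uncomputed x) a b c Y := by
  simp only [view, prob_uncomputed, regH, regT, regC, regE_mk, residues_apply_congr hi]
  congr!

lemma view_final_congr (hx : ∀ k, 0 < x k ∧ x k < 2 ^ m) (hx' : ∀ k, 0 < x' k ∧ x' k < 2 ^ m)
    (hT : Finset.univ.lcm x' = Finset.univ.lcm x) (hi : x' i = x i) (a b c : Fin (2 ^ u))
    (Y : Fin (2 ^ m)) : view i (final x') a b c Y = view i (final x) a b c Y := by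
  simp only [view, prob_final hx, prob_final hx', hT, regH, regT, regC, regE_mk, residues_apply_congr hi]
  congr!

lemma view_afterPeriodFinding_congr (hx : ∀ k, 0 < x k ∧ x k < 2 ^ m)
    (hx' : ∀ k, 0 < x' k ∧ x' k < 2 ^ m) (hT : Finset.univ.lcm x' = Finset.univ.lcm x)
    (hi : x' i = x i) (k a b c : Fin (2 ^ u)) (Y : Fin (2 ^ m)) :
    view i (afterPeriodFinding x' k) a b c Y = view i (afterPeriodFinding x k) a b c Y := by
  simp only [view, afterPeriodFinding, prob_collapse, prob_final hx, prob_final hx', hT,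
    regH, regT, regC, regE_mk, residues_apply_congr hi]
  congr!

lemma view_attackedCopy_congr (hx : ∀ k, 0 < x k ∧ x k < 2 ^ m)
    (hx' : ∀ k, 0 < x' k ∧ x' k < 2 ^ m) (hT : Finset.univ.lcm x' = Finset.univ.lcm x)
    (hi : x' i = x i) {s : ℕ} (hs : s ≤ n) (k a b c : Fin (2 ^ u)) (Y : Fin (2 ^ m)) :
    view i (attackedCopy x' s k) a b c Y = view i (attackedCopy x s k) a b c Y := by
  simp only [view, prob_attackedCopy hx hs, prob_attackedCopy hx' hs, hT,
    regH, regT, regC, regE_mk, residues_apply_congr hi]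
  congr!

end view

end QLCM
-- The three attacks assembled
open QLCM in
theorem theorem3 (n m u : ℕ) (x : Fin n → ℕ) (hx : ∀ k, 0 < x k ∧ x k < 2 ^ m)
    (T : ℕ) (hT : T = Finset.univ.lcm x) (i : Fin n) :
    -- Direct measurement while the oracles are being applied (`s` parties have finished).
    (∀ s ≤ n,
      (∀ j : Fin (2 ^ u), prob (stateAfter (m := m) x s) (fun w => regH w = j) = 1 / 2 ^ u) ∧
      (∀ j : Fin (2 ^ u), prob (stateAfter (m := m) x s) (fun w => regT w = j) = 1 / 2 ^ u) ∧
      (i.val < s → ∀ Y : Fin (2 ^ m),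
        prob (stateAfter (u := u) x s) (fun w => regE w i = Y) = residueFreq u (x i) Y)) ∧
    -- Direct measurement after the second CNOT, which leaves `t` in state zero.
    (prob (uncomputed (m := m) (u := u) x) (fun w => regT w = zeroBits u) = 1 ∧
      (∀ j : Fin (2 ^ u), prob (uncomputed (m := m) x) (fun w => regH w = j) = 1 / 2 ^ u) ∧
      (∀ Y : Fin (2 ^ m),
        prob (uncomputed (u := u) x) (fun w => regE w i = Y) = residueFreq u (x i) Y)) ∧
    -- Direct measurement of `e i` and of `h` at the end of period finding.
    ((∀ Y : Fin (2 ^ m),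
        prob (final (u := u) x) (fun w => regE w i = Y) = residueFreq u (x i) Y) ∧
      (∀ (k : Fin (2 ^ u)) (Y : Fin (2 ^ m)),
        prob (final x) (fun w => regH w = k ∧ regE w i = Y)
          = ∑ Z ∈ (Finset.range T).filter (fun Z => Z % x i = Y.val),
              classWeight u T Z k.val) ∧
      (T ∣ 2 ^ u → ∀ k : Fin (2 ^ u),
        ((2 ^ u / T) ∣ k.val →
          prob (final (m := m) x) (fun w => regH w = k) = 1 / T ∧
          ∀ Y : Fin (2 ^ m), Y.val < x i →
            prob (afterPeriodFinding x k) (fun w => regE w i = Y) = 1 / x i) ∧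
        (¬ (2 ^ u / T) ∣ k.val →
          prob (final (m := m) x) (fun w => regH w = k) = 0))) ∧
    -- The frequencies above are close to the uniform distribution on the residues modulo `x i`.
    (∀ Y < x i, |residueFreq u (x i) Y - 1 / x i| < 1 / 2 ^ u ∧
      (x i ∣ 2 ^ u → residueFreq u (x i) Y = 1 / x i)) ∧
    -- Inverse Fourier transform on `h` or on `t` before period finding.
    (∀ s ≤ n,
      (∀ k : Fin (2 ^ u),
        prob (onH (qftInv u) (stateAfter (m := m) x s)) (fun w => regH w = k) = 1 / 2 ^ u) ∧
      (∀ k : Fin (2 ^ u),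
        prob (onT (qftInv u) (stateAfter (m := m) x s)) (fun w => regT w = k) = 1 / 2 ^ u)) ∧
    -- Copying `t` at time `s`, and a Fourier transform on the copy after period finding.
    (∀ s ≤ n,
      prob (uncomputedCopy (m := m) (u := u) x s) (fun w => regT w = zeroBits u) = 1 ∧
      (∀ k : Fin (2 ^ u),
        prob (finalCopy (m := m) x s) (fun w => regH w = k) = 1 / 2 ^ u) ∧
      (∀ k l : Fin (2 ^ u),
        prob (attackedCopy (m := m) x s k) (fun w => regC w = l)
          = ∑ Z ∈ Finset.range T, classWeight u T Z ((l.val : ℤ) - k.val)) ∧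
      (T ∣ 2 ^ u → ∀ k l : Fin (2 ^ u),
        ((∃ r < T, l.val = (k.val + r * (2 ^ u / T)) % 2 ^ u) →
          prob (attackedCopy (m := m) x s k) (fun w => regC w = l) = 1 / T) ∧
        ((¬ ∃ r < T, l.val = (k.val + r * (2 ^ u / T)) % 2 ^ u) →
          prob (attackedCopy (m := m) x s k) (fun w => regC w = l) = 0)) ∧
      (∀ l : Fin (2 ^ u),
        ∑ k : Fin (2 ^ u), prob (finalCopy (m := m) x s) (fun w => regH w = k)
          * prob (attackedCopy (m := m) x s k) (fun w => regC w = l) = 1 / 2 ^ u)) ∧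
    -- Nothing beyond the attacker's own input is revealed before period finding is completed,
    -- and nothing beyond that input and `T` afterwards, even by joint measurements.
    (∀ x' : Fin n → ℕ, (∀ k, 0 < x' k ∧ x' k < 2 ^ m) → x' i = x i →
      (∀ s ≤ n, ∀ (a b c : Fin (2 ^ u)) (Y : Fin (2 ^ m)),
        view i (stateAfter x' s) a b c Y = view i (stateAfter x s) a b c Y ∧
        view i (onH (qftInv u) (stateAfter x' s)) a b c Y
          = view i (onH (qftInv u) (stateAfter x s)) a b c Y ∧
        view i (onT (qftInv u) (stateAfter x' s)) a b c Y
          = view i (onT (qftInv u) (stateAfter x s)) a b c Y) ∧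
      (∀ (a b c : Fin (2 ^ u)) (Y : Fin (2 ^ m)),
        view i (uncomputed x') a b c Y = view i (uncomputed x) a b c Y) ∧
      (Finset.univ.lcm x' = T →
        (∀ (a b c : Fin (2 ^ u)) (Y : Fin (2 ^ m)),
          view i (final x') a b c Y = view i (final x) a b c Y) ∧
        (∀ (k a b c : Fin (2 ^ u)) (Y : Fin (2 ^ m)),
          view i (afterPeriodFinding x' k) a b c Y = view i (afterPeriodFinding x k) a b c Y) ∧
        (∀ s ≤ n, ∀ (k a b c : Fin (2 ^ u)) (Y : Fin (2 ^ m)),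
          prob (finalCopy (m := m) x' s) (fun w => regH w = k)
            = prob (finalCopy (m := m) x s) (fun w => regH w = k) ∧
          view i (attackedCopy x' s k) a b c Y = view i (attackedCopy x s k) a b c Y))) := by
  subst hT
  have hpos := lcm_pos fun k => (hx k).1
  refine ⟨fun s _ => ⟨fun j => ?_, fun j => ?_, fun his Y => ?_⟩,
    ⟨prob_uncomputed_regT x, fun j => ?_, fun Y => ?_⟩,
    ⟨prob_final_regE hx i, prob_final_regH_regE hx i, fun hd k => ⟨fun hk => ⟨?_, fun Y hY =>
      prob_afterPeriodFinding_of_dvd hx i hd hk hY⟩, fun hk => ?_⟩⟩,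
    fun Y hY => ⟨abs_residueFreq_sub_lt hY u, residueFreq_of_dvd hY⟩,
    fun s _ => ⟨fun k => ?_, fun k => ?_⟩,
    fun s hs => ⟨prob_uncomputedCopy_regT x hs, prob_finalCopy_regH x hs,
      prob_attackedCopy_regC hx hs, fun hd k l => ?_, fun l => ?_⟩,
    fun x' hx' hi => ⟨fun s _ a b c Y => ⟨view_stateAfter_congr hi s a b c Y,
      view_onH_stateAfter_congr hi s a b c Y, view_onT_stateAfter_congr hi s a b c Y⟩,
      view_uncomputed_congr hi, fun hT => ⟨view_final_congr hx hx' hT hi,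
      view_afterPeriodFinding_congr hx hx' hT hi, fun s hs k a b c Y =>
      ⟨by rw [prob_finalCopy_regH x' hs, prob_finalCopy_regH x hs],
      view_attackedCopy_congr hx hx' hT hi hs k a b c Y⟩⟩⟩⟩
  · rw [prob_stateAfter]
    simp [regH]
  · rw [prob_stateAfter]
    simp [regT]
  · rw [prob_stateAfter, ← sum_ite_mod_eq_residueFreq]
    have h : ∀ y : Fin (2 ^ u), memory m x s y i = Y ↔ y.val % x i = Y.val := by
      intro y
      rw [← residues_apply_eq_iff (hx i)]
      simp [memory, his, residues, residue]
    simp only [regE_mk, h]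
  · rw [prob_uncomputed]
    simp [regH]
  · rw [prob_uncomputed, ← sum_ite_mod_eq_residueFreq]
    simp only [regE_mk, residues_apply_eq_iff (hx i)]
  · rw [prob_final_regH hx, sum_classWeight_range_of_dvd hpos hd,
      if_pos (Int.natCast_dvd_natCast.2 hk)]
  · rw [prob_final_regH hx, sum_classWeight_range_of_dvd hpos hd,
      if_neg fun h => hk (Int.natCast_dvd_natCast.1 h)]
  · rw [prob_onH_stateAfter]
    simp [regH]
    field_simp
  · rw [prob_onT_stateAfter]
    simp [regT]
    field_simp
  · rw [exists_shift_iff hpos hd k.isLt l.isLt, prob_attackedCopy_regC hx hs,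
      sum_classWeight_range_of_dvd hpos hd]
    exact ⟨fun h => if_pos h, fun h => if_neg h⟩
  -- Since `k` is uniform, Parseval for each class turns the average into the total of the class
  -- frequencies, which is `1`.
  · simp only [prob_finalCopy_regH x hs, prob_attackedCopy_regC hx hs, ← Finset.mul_sum]
    rw [Finset.sum_comm]
    simp only [sum_classWeight_sub, sum_residueFreq_range hpos, mul_one]
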